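/- Identify the complex projective line $\mathbb{P}^1$ with the unit sphere $S^2\subset\mathbb{R}^3$ in the standard way, $[z:w]\mapsto \frac{1}{|z|^2+|w|^2}\left(2\,\mathrm{Re}(\bar z w),\,2\,\mathrm{Im}(\bar z w),\,|z|^2-|w|^2\right)$, and let $SL(2,\mathbb{C})$ act on $S^2$ through this identification and its standard linear action on $\mathbb{P}^1$. Consider a nonempty configuration of finitely many distinct points $p_1,\dots,p_k\in S^2$ with multiplicities $m_1,\dots,m_k\in\mathbb{Z}_{>0}$, and let $n=\sum_i m_i$ be the total multiplicity. Then there is $g\in SL(2,\mathbb{C})$ such that the moved configuration has centre of mass at the origin, i.e. $\frac1n\sum_{i=1}^k m_i\, g(p_i)=0\in\mathbb{R}^3$, if and only if one of the following holds: (a) every multiplicity is strictly less than half the total, i.e. $m_i<n/2$ for all $i$; or (b) there are exactly two distinct points and they have the same multiplicity, i.e. $k=2$ and $m_1=m_2$. -/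

import Mathlib

open scoped LinearAlgebra.Projectivization ComplexConjugate

noncomputable section

/-- The complex projective line `ℙ¹`, i.e. the space of lines in `ℂ²`. -/
abbrev CP1 : Type := ℙ ℂ (Fin 2 → ℂ)

/-- The unit sphere `S² ⊂ ℝ³`. -/
abbrev S2 : Type := Metric.sphere (0 : EuclideanSpace ℝ (Fin 3)) 1

/-- The vector of `ℝ³` that the standard identification `ℙ¹ ≅ S²` attaches to `(z, w) ∈ ℂ²`:
`(2 Re (z̄ w), 2 Im (z̄ w), |z|² - |w|²) / (|z|² + |w|²)`. In the chart `ζ = w / z` this is inverse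
stereographic projection, and it is the moment map of `SU(2)` on `ℙ¹`, with `𝔰𝔲(2)*` identified
with `ℝ³` through the Pauli matrices. -/
def hopfVec (v : Fin 2 → ℂ) : EuclideanSpace ℝ (Fin 3) :=
  (Complex.normSq (v 0) + Complex.normSq (v 1))⁻¹ •
    !₂[2 * (conj (v 0) * v 1).re, 2 * (conj (v 0) * v 1).im,
      Complex.normSq (v 0) - Complex.normSq (v 1)]

theorem hopf_normSq_pos {v : Fin 2 → ℂ} (hv : v ≠ 0) :
    0 < Complex.normSq (v 0) + Complex.normSq (v 1) := by
  have h0 := Complex.normSq_nonneg (v 0)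
  have h1 := Complex.normSq_nonneg (v 1)
  by_contra hcon
  apply hv
  have e0 : Complex.normSq (v 0) = 0 := by linarith
  have e1 : Complex.normSq (v 1) = 0 := by linarith
  ext i
  fin_cases i
  · simpa using e0
  · simpa using e1

theorem hopfVec_mem_sphere {v : Fin 2 → ℂ} (hv : v ≠ 0) :
    hopfVec v ∈ Metric.sphere (0 : EuclideanSpace ℝ (Fin 3)) 1 := by
  have h := hopf_normSq_pos hv
  rw [mem_sphere_zero_iff_norm, EuclideanSpace.norm_eq, Real.sqrt_eq_one]
  simp only [hopfVec, Fin.sum_univ_three, Real.norm_eq_abs, sq_abs, PiLp.smul_apply, smul_eq_mul,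
    Matrix.cons_val]
  have h' := h.ne'
  field_simp
  simp only [Complex.normSq_apply, Complex.mul_re, Complex.mul_im, Complex.conj_re,
    Complex.conj_im]
  ring

theorem hopfVec_smul (a : ℂ) (ha : a ≠ 0) (v : Fin 2 → ℂ) : hopfVec (a • v) = hopfVec v := by
  have ha' : Complex.normSq a ≠ 0 := by simpa using ha
  have key : conj (a * v 0) * (a * v 1) = (Complex.normSq a : ℂ) * (conj (v 0) * v 1) := by
    rw [Complex.normSq_eq_conj_mul_self, map_mul]; ring
  ext i
  simp only [hopfVec, Pi.smul_apply, smul_eq_mul, key, Complex.normSq_mul, ← mul_add, mul_inv]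
  fin_cases i <;> simp <;> field_simp

/-- The standard identification of `ℙ¹` with `S²`, as a map. -/
def hopfMap : CP1 → S2 :=
  Projectivization.lift (fun v => ⟨hopfVec v.1, hopfVec_mem_sphere v.2⟩) (by
    rintro ⟨v, hv⟩ ⟨w, hw⟩ t h
    have ht : t ≠ 0 := by rintro rfl; simp at h; exact hv h
    apply Subtype.ext
    simp only at h ⊢
    rw [h, hopfVec_smul t ht])

theorem hopfMap_mk (v : Fin 2 → ℂ) (hv : v ≠ 0) :
    (hopfMap (Projectivization.mk ℂ v hv) : EuclideanSpace ℝ (Fin 3)) = hopfVec v := rfl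

theorem hopfMap_injective : Function.Injective hopfMap := by
  intro p q
  induction p using Projectivization.ind with | h v hv => ?_
  induction q using Projectivization.ind with | h w hw => ?_
  intro h
  have h' := congrArg Subtype.val h
  rw [hopfMap_mk, hopfMap_mk] at h'
  have e0 := congrFun (congrArg WithLp.ofLp h') 0
  have e1 := congrFun (congrArg WithLp.ofLp h') 1
  have e2 := congrFun (congrArg WithLp.ofLp h') 2
  have pv := hopf_normSq_pos hv
  have pw := hopf_normSq_pos hw
  have hv1 := hopfVec_mem_sphere hv
  rw [mem_sphere_zero_iff_norm, EuclideanSpace.norm_eq, Real.sqrt_eq_one] at hv1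
  simp only [Fin.sum_univ_three, Real.norm_eq_abs, sq_abs] at hv1
  have hdot : hopfVec v 0 * hopfVec w 0 + hopfVec v 1 * hopfVec w 1 + hopfVec v 2 * hopfVec w 2
      = 1 := by rw [← e0, ← e1, ← e2]; linarith
  have hdet : Complex.normSq (v 0 * w 1 - v 1 * w 0) = 0 := by
    simp only [hopfVec, PiLp.smul_apply, smul_eq_mul, Matrix.cons_val] at hdot
    have pv' := pv.ne'
    have pw' := pw.ne'
    field_simp at hdot
    simp only [Complex.normSq_apply, Complex.mul_re, Complex.mul_im, Complex.conj_re,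
      Complex.conj_im, Complex.sub_re, Complex.sub_im] at hdot ⊢
    linarith
  have hdet' : v 0 * w 1 = v 1 * w 0 := by
    rw [Complex.normSq_eq_zero, sub_eq_zero] at hdet; exact hdet
  rw [Projectivization.mk_eq_mk_iff']
  by_cases hw0 : w 0 = 0
  · have hw1 : w 1 ≠ 0 := by
      intro hw1; apply hw; ext i; fin_cases i <;> simp [hw0, hw1]
    refine ⟨v 1 / w 1, ?_⟩
    ext i; fin_cases i
    · have : v 0 = 0 := by
        rw [hw0, mul_zero] at hdet'
        exact (mul_eq_zero.mp hdet').resolve_right hw1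
      simp [hw0, this]
    · simp [hw1]
  · refine ⟨v 0 / w 0, ?_⟩
    ext i; fin_cases i
    · simp [hw0]
    · simp only [Fin.mk_one, Pi.smul_apply, smul_eq_mul]
      field_simp
      linear_combination hdet'

theorem hopfMap_surjective : Function.Surjective hopfMap := by
  rintro ⟨p, hp⟩
  have hp' := hp
  rw [mem_sphere_zero_iff_norm, EuclideanSpace.norm_eq, Real.sqrt_eq_one] at hp'
  simp only [Fin.sum_univ_three, Real.norm_eq_abs, sq_abs] at hp'
  by_cases hz : 1 + p 2 = 0
  · have hz' : p 2 = -1 := by linarith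
    have h0 : p 0 = 0 := by nlinarith [sq_nonneg (p 0), sq_nonneg (p 1)]
    have h1 : p 1 = 0 := by nlinarith [sq_nonneg (p 0), sq_nonneg (p 1)]
    have hv : (![0, 1] : Fin 2 → ℂ) ≠ 0 := fun h => by simpa using congrFun h 1
    refine ⟨Projectivization.mk ℂ _ hv, Subtype.ext ?_⟩
    rw [hopfMap_mk]
    ext i
    fin_cases i <;> simp [hopfVec, h0, h1, hz']
  · have hv : (![((1 + p 2 : ℝ) : ℂ), ⟨p 0, p 1⟩] : Fin 2 → ℂ) ≠ 0 := fun h => hz (by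
      have := congrFun h 0
      simp only [Matrix.cons_val_zero, Pi.zero_apply] at this
      exact Complex.ofReal_eq_zero.mp this)
    refine ⟨Projectivization.mk ℂ _ hv, Subtype.ext ?_⟩
    rw [hopfMap_mk]
    have hN : (1 + p 2) * (1 + p 2) + (p 0 * p 0 + p 1 * p 1) = 2 * (1 + p 2) := by
      linarith
    ext i
    simp only [hopfVec, Matrix.cons_val_zero, Matrix.cons_val_one, Complex.normSq_apply,
      Complex.mul_re, Complex.mul_im, Complex.conj_re, Complex.conj_im, Complex.ofReal_re,
      Complex.ofReal_im, mul_zero, add_zero, hN, PiLp.smul_apply, smul_eq_mul]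
    fin_cases i
    · simp; field_simp
    · simp; field_simp
    · simp only [Fin.reduceFinMk, Matrix.cons_val]
      field_simp
      linarith

/-- The standard identification `ℙ¹ ≃ S²`. -/
def hopfEquiv : CP1 ≃ S2 := Equiv.ofBijective hopfMap ⟨hopfMap_injective, hopfMap_surjective⟩

/-- The action of `SL(2, ℂ)` on `S²` (by Möbius transformations): its standard linear action on
`ℙ¹`, transported along `ℙ¹ ≃ S²`. -/
def moebius (g : Matrix.SpecialLinearGroup (Fin 2) ℂ) (p : S2) : S2 :=
  hopfEquiv (g • hopfEquiv.symm p)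

/-- A configuration of points with multiplicities on `S²`: finitely many points carry a positive
multiplicity `D p`, all others have `D p = 0`. -/
abbrev PointConfig : Type := S2 →₀ ℕ

namespace PointConfig

/-- The total multiplicity, i.e. the number of points counted with multiplicity. -/
def total (D : PointConfig) : ℕ := D.sum fun _ m => m

/-- The centre of mass `(1 / n) ∑ m_p p ∈ ℝ³`, with `n` the total multiplicity. -/
def centreOfMass (D : PointConfig) : EuclideanSpace ℝ (Fin 3) :=
  (D.total : ℝ)⁻¹ • D.sum fun p m => (m : ℝ) • (p : EuclideanSpace ℝ (Fin 3))

/-- The configuration moved by `g ∈ SL(2, ℂ)`: each point `p` goes to `g p`, with its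
multiplicity. -/
def move (g : Matrix.SpecialLinearGroup (Fin 2) ℂ) (D : PointConfig) : PointConfig :=
  D.mapDomain (moebius g)

end PointConfig

end

/-! ### The squared Hermitian norm on `ℂ²` -/

/-! This is a Kempf–Ness argument. Choose vectors `v_i` in `ℂ²` spanning the given lines and put
`F(M) = ∑ m_i log ‖M v_i‖²` on `SL(2, ℂ)`. The derivative of `F` at `M` along the boost in direction
`u` is `2 ⟨u, X⟩`, where `X` is the weighted sum of the moved points, so a minimiser of `F` balances
the configuration (`sum_smul_hopfVec_eq_zero_of_isMinOn`). A minimiser exists under (a) because `F`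
is coercive. If the largest entry of `M` has size `R`, at most one of the `‖M v_i‖²` can be as small
as a constant times `R⁻²`, and the others are at least a constant times `R²`. Hence `F(M) ≥ K + 2 (n
- 2 m_p) log R` for some `p`, and `n - 2 m_p > 0` (`exists_logNormSum_lower_bound`). In case (b),
two-transitivity on `ℙ¹` makes the two points antipodal. Conversely, pairing the balance equation
with a point of multiplicity at least `n/2` forces all other mass to its antipode
(`card_eq_two_of_sum_eq_zero`). -/

/-- The squared Hermitian norm of a vector of `ℂ²`. -/
def hermSq (v : Fin 2 → ℂ) : ℝ := Complex.normSq (v 0) + Complex.normSq (v 1)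

theorem hermSq_pos {v : Fin 2 → ℂ} (hv : v ≠ 0) : 0 < hermSq v := hopf_normSq_pos hv

theorem continuous_hermSq : Continuous hermSq := by
  unfold hermSq
  exact (Complex.continuous_normSq.comp (continuous_apply 0)).add
    (Complex.continuous_normSq.comp (continuous_apply 1))

theorem norm_sq_apply_le_hermSq (v : Fin 2 → ℂ) (i : Fin 2) : ‖v i‖ ^ 2 ≤ hermSq v := by
  have h0 := Complex.normSq_nonneg (v 0)
  have h1 := Complex.normSq_nonneg (v 1)
  rw [← Complex.normSq_eq_norm_sq, hermSq]
  fin_cases i <;> simp <;> assumption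

theorem norm_apply_le_sqrt_hermSq (v : Fin 2 → ℂ) (i : Fin 2) : ‖v i‖ ≤ √(hermSq v) :=
  Real.le_sqrt_of_sq_le (norm_sq_apply_le_hermSq v i)

theorem mulVec_ne_zero_of_det_eq_one {M : Matrix (Fin 2) (Fin 2) ℂ} (hM : M.det = 1)
    {v : Fin 2 → ℂ} (hv : v ≠ 0) : M.mulVec v ≠ 0 := fun h =>
  hv (Matrix.eq_zero_of_mulVec_eq_zero (by simp [hM]) h)

theorem mulVec_fin_two_apply (M : Matrix (Fin 2) (Fin 2) ℂ) (v : Fin 2 → ℂ) (i : Fin 2) :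
    M.mulVec v i = M i 0 * v 0 + M i 1 * v 1 := by
  rw [Matrix.mulVec, dotProduct, Fin.sum_univ_two]

/-! ### Entry bounds for matrices of determinant one -/

/-- Since `det M = 1`, the inverse is the adjugate, whose entries are also bounded by `R`;
recovering `v` from `M v` costs at most a factor of order `R`. -/
theorem exists_hermSq_mulVec_lower_bound {v : Fin 2 → ℂ} (hv : v ≠ 0) :
    ∃ c : ℝ, 0 < c ∧ ∀ (M : Matrix (Fin 2) (Fin 2) ℂ) (R : ℝ), M.det = 1 →
      (∀ i j, ‖M i j‖ ≤ R) → c ≤ R ^ 2 * hermSq (M.mulVec v) := by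
  obtain ⟨i, hi⟩ := Function.ne_iff.mp hv
  have hi' : 0 < ‖v i‖ := norm_pos_iff.mpr hi
  refine ⟨(‖v i‖ / 2) ^ 2, by positivity, fun M R hM hR => ?_⟩
  rw [Matrix.det_fin_two] at hM
  have hR0 : 0 ≤ R := (norm_nonneg _).trans (hR 0 0)
  have hH : 0 ≤ hermSq (M.mulVec v) :=
    add_nonneg (Complex.normSq_nonneg _) (Complex.normSq_nonneg _)
  set w := M.mulVec v with hw
  have hw0 : w 0 = M 0 0 * v 0 + M 0 1 * v 1 := mulVec_fin_two_apply _ _ _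
  have hw1 : w 1 = M 1 0 * v 0 + M 1 1 * v 1 := mulVec_fin_two_apply _ _ _
  have aux : ∀ a b : ℂ, ‖a‖ ≤ R → ‖b‖ ≤ R → ‖a * w 0 - b * w 1‖ ≤ 2 * (R * √(hermSq w)) := by
    intro a b ha hb
    refine (norm_sub_le _ _).trans ?_
    rw [norm_mul, norm_mul]
    have h0 := mul_le_mul ha (norm_apply_le_sqrt_hermSq w 0) (norm_nonneg _) hR0
    have h1 := mul_le_mul hb (norm_apply_le_sqrt_hermSq w 1) (norm_nonneg _) hR0
    linarith
  have key : ‖v i‖ ≤ 2 * (R * √(hermSq w)) := by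
    fin_cases i
    · have e : v 0 = M 1 1 * w 0 - M 0 1 * w 1 := by
        rw [hw0, hw1]; linear_combination (-v 0) * hM
      simpa [← e] using aux _ _ (hR 1 1) (hR 0 1)
    · have e : v 1 = -(M 1 0 * w 0 - M 0 0 * w 1) := by
        rw [hw0, hw1]; linear_combination (-v 1) * hM
      have := aux _ _ (hR 1 0) (hR 0 0)
      rw [← norm_neg, ← e] at this
      simpa using this
  calc (‖v i‖ / 2) ^ 2 ≤ (R * √(hermSq w)) ^ 2 := by gcongr; linarith
    _ = R ^ 2 * hermSq w := by rw [mul_pow, Real.sq_sqrt hH]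

/-- Cramer's rule: independent `v`, `w` determine `M` from `M v` and `M w`, so both images cannot be
short when `M` has a large entry. -/
theorem exists_entry_sq_le_max_hermSq {v w : Fin 2 → ℂ} (h : v 0 * w 1 - v 1 * w 0 ≠ 0) :
    ∃ c : ℝ, 0 < c ∧ ∀ (M : Matrix (Fin 2) (Fin 2) ℂ) (i j : Fin 2),
      c * ‖M i j‖ ^ 2 ≤ max (hermSq (M.mulVec v)) (hermSq (M.mulVec w)) := by
  set δ := v 0 * w 1 - v 1 * w 0 with hδ
  set B := √(hermSq v) + √(hermSq w) + 1 with hB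
  have hBpos : 0 < B := by positivity
  have hvB : ∀ i, ‖v i‖ ≤ B := fun i => by
    linarith [norm_apply_le_sqrt_hermSq v i, Real.sqrt_nonneg (hermSq w)]
  have hwB : ∀ i, ‖w i‖ ≤ B := fun i => by
    linarith [norm_apply_le_sqrt_hermSq w i, Real.sqrt_nonneg (hermSq v)]
  have hδpos : 0 < ‖δ‖ := norm_pos_iff.mpr h
  refine ⟨(‖δ‖ / (2 * B)) ^ 2, by positivity, fun M i j => ?_⟩
  set x := M.mulVec v with hx
  set y := M.mulVec w with hy
  have hxi : x i = M i 0 * v 0 + M i 1 * v 1 := mulVec_fin_two_apply _ _ _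
  have hyi : y i = M i 0 * w 0 + M i 1 * w 1 := mulVec_fin_two_apply _ _ _
  set m := max (hermSq x) (hermSq y) with hm
  have hm0 : 0 ≤ m := (add_nonneg (Complex.normSq_nonneg _) (Complex.normSq_nonneg _) :
    0 ≤ hermSq x).trans (le_max_left _ _)
  have hxm : ‖x i‖ ≤ √m :=
    (norm_apply_le_sqrt_hermSq x i).trans (Real.sqrt_le_sqrt (le_max_left _ _))
  have hym : ‖y i‖ ≤ √m :=
    (norm_apply_le_sqrt_hermSq y i).trans (Real.sqrt_le_sqrt (le_max_right _ _))
  have aux : ∀ a b : ℂ, ‖a‖ ≤ B → ‖b‖ ≤ B → ‖a * x i - b * y i‖ ≤ 2 * (B * √m) := by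
    intro a b ha hb
    refine (norm_sub_le _ _).trans ?_
    rw [norm_mul, norm_mul]
    have h0 := mul_le_mul ha hxm (norm_nonneg _) hBpos.le
    have h1 := mul_le_mul hb hym (norm_nonneg _) hBpos.le
    linarith
  have key : ‖δ‖ * ‖M i j‖ ≤ 2 * (B * √m) := by
    rw [← norm_mul]
    fin_cases j
    · have e : δ * M i 0 = w 1 * x i - v 1 * y i := by rw [hxi, hyi, hδ]; ring
      simpa [← e] using aux _ _ (hwB 1) (hvB 1)
    · have e : δ * M i 1 = -(w 0 * x i - v 0 * y i) := by rw [hxi, hyi, hδ]; ring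
      have := aux _ _ (hwB 0) (hvB 0)
      rw [← norm_neg, ← e] at this
      simpa using this
  have key' : ‖δ‖ / (2 * B) * ‖M i j‖ ≤ √m := by
    rw [div_mul_eq_mul_div, div_le_iff₀ (by positivity)]; linarith
  calc (‖δ‖ / (2 * B)) ^ 2 * ‖M i j‖ ^ 2 = (‖δ‖ / (2 * B) * ‖M i j‖) ^ 2 := by ring
    _ ≤ √m ^ 2 := by gcongr
    _ = m := Real.sq_sqrt hm0

/-! ### The logarithmic norm functional -/

/-- The weighted sum of the logarithms of the squared norms of the vectors `M v_i`. -/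
noncomputable def logNormSum {ι : Type*} (s : Finset ι) (m : ι → ℕ) (v : ι → Fin 2 → ℂ)
    (M : Matrix (Fin 2) (Fin 2) ℂ) : ℝ :=
  ∑ i ∈ s, (m i : ℝ) * Real.log (hermSq (M.mulVec (v i)))

theorem exists_uniform_bounds {ι : Type*} (s : Finset ι) {v : ι → Fin 2 → ℂ} (hv : ∀ i, v i ≠ 0)
    (hvv : ∀ i ∈ s, ∀ j ∈ s, i ≠ j → v i 0 * v j 1 - v i 1 * v j 0 ≠ 0) :
    ∃ c : ℝ, 0 < c ∧
      (∀ i ∈ s, ∀ (M : Matrix (Fin 2) (Fin 2) ℂ) (R : ℝ), M.det = 1 →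
        (∀ a b, ‖M a b‖ ≤ R) → c ≤ R ^ 2 * hermSq (M.mulVec (v i))) ∧
      ∀ i ∈ s, ∀ j ∈ s, i ≠ j → ∀ (M : Matrix (Fin 2) (Fin 2) ℂ) (a b : Fin 2),
        c * ‖M a b‖ ^ 2 ≤ max (hermSq (M.mulVec (v i))) (hermSq (M.mulVec (v j))) := by
  -- Each estimate survives shrinking its constant, so finitely many of them hold together for all
  -- small `c > 0`.
  have h1 : ∀ᶠ c in nhdsWithin (0 : ℝ) (Set.Ioi 0), ∀ i ∈ s,
      ∀ (M : Matrix (Fin 2) (Fin 2) ℂ) (R : ℝ), M.det = 1 →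
        (∀ a b, ‖M a b‖ ≤ R) → c ≤ R ^ 2 * hermSq (M.mulVec (v i)) := by
    rw [Filter.eventually_all_finset]
    intro i _
    obtain ⟨c, hc, H⟩ := exists_hermSq_mulVec_lower_bound (hv i)
    filter_upwards [Ioo_mem_nhdsGT hc] with d hd M R hM hR
    exact hd.2.le.trans (H M R hM hR)
  have h2 : ∀ᶠ c in nhdsWithin (0 : ℝ) (Set.Ioi 0), ∀ i ∈ s, ∀ j ∈ s,
      i ≠ j → ∀ (M : Matrix (Fin 2) (Fin 2) ℂ) (a b : Fin 2),
        c * ‖M a b‖ ^ 2 ≤ max (hermSq (M.mulVec (v i))) (hermSq (M.mulVec (v j))) := by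
    rw [Filter.eventually_all_finset]
    intro i hi
    rw [Filter.eventually_all_finset]
    intro j hj
    by_cases hij : i = j
    · exact Filter.Eventually.of_forall fun c h => absurd hij h
    obtain ⟨c, hc, H⟩ := exists_entry_sq_le_max_hermSq (hvv i hi j hj hij)
    filter_upwards [Ioo_mem_nhdsGT hc] with d hd _ M a b
    exact (mul_le_mul_of_nonneg_right hd.2.le (sq_nonneg _)).trans (H M a b)
  obtain ⟨c, hc, hc1, hc2⟩ := ((eventually_mem_nhdsWithin (a := (0 : ℝ)) (s := Set.Ioi 0)).and (h1.and h2)).exists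
  exact ⟨c, hc, hc1, hc2⟩

theorem exists_logNormSum_lower_bound {ι : Type*} {s : Finset ι} (hs : s.Nonempty) {m : ι → ℕ}
    (hm : ∀ i ∈ s, 2 * m i < ∑ j ∈ s, m j) {v : ι → Fin 2 → ℂ} (hv : ∀ i, v i ≠ 0)
    (hvv : ∀ i ∈ s, ∀ j ∈ s, i ≠ j → v i 0 * v j 1 - v i 1 * v j 0 ≠ 0) :
    ∃ K : ℝ, ∀ (M : Matrix (Fin 2) (Fin 2) ℂ) (a b : Fin 2), M.det = 1 → 1 ≤ ‖M a b‖ →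
      (∀ i j, ‖M i j‖ ≤ ‖M a b‖) → K + 2 * Real.log ‖M a b‖ ≤ logNormSum s m v M := by
  obtain ⟨c, hc, H1, H2⟩ := exists_uniform_bounds s hv hvv
  refine ⟨(∑ j ∈ s, (m j : ℝ)) * Real.log c, fun M a b hM hR1 hR => ?_⟩
  set R := ‖M a b‖ with hRdef
  have hR0 : 0 < R := by linarith
  have hL : 0 ≤ Real.log R := Real.log_nonneg hR1
  have hpos : ∀ i, 0 < hermSq (M.mulVec (v i)) := fun i =>
    hermSq_pos (mulVec_ne_zero_of_det_eq_one hM (hv i))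
  -- Take `p` with the shortest image: in every pair with `p` the other image attains the maximum,
  -- so it is long.
  obtain ⟨p, hp, hmin⟩ := s.exists_min_image (fun i => hermSq (M.mulVec (v i))) hs
  have hlow : Real.log c - 2 * Real.log R ≤ Real.log (hermSq (M.mulVec (v p))) := by
    have := Real.log_le_log hc (H1 p hp M R hM hR)
    rw [Real.log_mul (by positivity) (hpos p).ne', Real.log_pow] at this
    push_cast at this
    linarith
  have hhigh : ∀ q ∈ s, q ≠ p →
      Real.log c + 2 * Real.log R ≤ Real.log (hermSq (M.mulVec (v q))) := by
    intro q hq hqp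
    have h := H2 q hq p hp hqp M a b
    rw [max_eq_left (hmin q hq)] at h
    have := Real.log_le_log (by positivity) h
    rw [Real.log_mul hc.ne' (by positivity), Real.log_pow] at this
    exact_mod_cast this
  classical
  -- The correction `4 m_p log R` is the gap between the `+2 log R` and `-2 log R` bounds, needed
  -- only at `p`.
  have hterm : ∀ q ∈ s, (m q : ℝ) * (Real.log c + 2 * Real.log R)
      - (if q = p then 4 * (m p : ℝ) * Real.log R else 0)
      ≤ (m q : ℝ) * Real.log (hermSq (M.mulVec (v q))) := by
    intro q hq
    split_ifs with hqp
    · subst hqp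
      have := mul_le_mul_of_nonneg_left hlow (Nat.cast_nonneg (α := ℝ) (m q))
      linarith
    · rw [sub_zero]
      exact mul_le_mul_of_nonneg_left (hhigh q hq hqp) (Nat.cast_nonneg _)
  have hsum := Finset.sum_le_sum hterm
  rw [Finset.sum_sub_distrib, Finset.sum_ite_eq' s p, if_pos hp, ← Finset.sum_mul] at hsum
  -- Integrality makes the gap `n - 2 m_p` at least one, hence the uniform slope `2` in `log R`.
  have hmp : 2 * (m p : ℝ) + 1 ≤ ∑ j ∈ s, (m j : ℝ) := by exact_mod_cast hm p hp
  have := mul_le_mul_of_nonneg_right hmp hL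
  unfold logNormSum
  linarith

theorem continuousOn_logNormSum {ι : Type*} (s : Finset ι) (m : ι → ℕ) {v : ι → Fin 2 → ℂ}
    (hv : ∀ i, v i ≠ 0) : ContinuousOn (logNormSum s m v) {M | M.det = 1} := by
  unfold logNormSum
  refine continuousOn_finsetSum _ fun i _ => continuousOn_const.mul ?_
  refine ContinuousOn.log ?_ fun M hM => (hermSq_pos (mulVec_ne_zero_of_det_eq_one hM (hv i))).ne'
  exact (continuous_hermSq.comp (continuous_id.matrix_mulVec continuous_const)).continuousOn

theorem isCompact_setOf_norm_apply_le (R : ℝ) :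
    IsCompact {M : Matrix (Fin 2) (Fin 2) ℂ | ∀ i j, ‖M i j‖ ≤ R} := by
  have h : IsCompact (Set.univ.pi fun _ : Fin 2 => Set.univ.pi fun _ : Fin 2 =>
      Metric.closedBall (0 : ℂ) R) :=
    isCompact_univ_pi fun _ => isCompact_univ_pi fun _ => isCompact_closedBall _ _
  simp only [Set.pi, Set.mem_univ, true_imp_iff, mem_closedBall_zero_iff] at h
  exact h

theorem exists_isMinOn_logNormSum {ι : Type*} {s : Finset ι} (hs : s.Nonempty) {m : ι → ℕ}
    (hm : ∀ i ∈ s, 2 * m i < ∑ j ∈ s, m j) {v : ι → Fin 2 → ℂ} (hv : ∀ i, v i ≠ 0)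
    (hvv : ∀ i ∈ s, ∀ j ∈ s, i ≠ j → v i 0 * v j 1 - v i 1 * v j 0 ≠ 0) :
    ∃ M ∈ {M : Matrix (Fin 2) (Fin 2) ℂ | M.det = 1},
      IsMinOn (logNormSum s m v) {M | M.det = 1} M := by
  obtain ⟨K, hK⟩ := exists_logNormSum_lower_bound hs hm hv hvv
  refine (continuousOn_logNormSum s m hv).exists_isMinOn'
    (isClosed_eq (continuous_id.matrix_det) continuous_const) (x₀ := 1) (by simp) ?_
  -- Outside the compact set of entries at most `exp L`, the lower bound is at least `K + 2 L ≥ K +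
  -- L`, which is no less than the value at `1`; `L ≥ 0` supplies `1 ≤ ‖M a b‖`.
  set L := max 0 (logNormSum s m v 1 - K) with hL
  rw [Filter.eventually_inf_principal]
  filter_upwards [(isCompact_setOf_norm_apply_le (Real.exp L)).compl_mem_cocompact] with M hM hdet
  obtain ⟨⟨a, b⟩, hab⟩ := Finite.exists_max fun x : Fin 2 × Fin 2 => ‖M x.1 x.2‖
  have hmax : ∀ i j, ‖M i j‖ ≤ ‖M a b‖ := fun i j => hab (i, j)
  have hbig : Real.exp L < ‖M a b‖ := by
    by_contra! hcon
    exact hM fun i j => (hmax i j).trans hcon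
  have hL0 : 0 ≤ L := le_max_left _ _
  have h1 : 1 ≤ ‖M a b‖ := (Real.one_le_exp hL0).trans hbig.le
  have h2 := hK M a b hdet h1 hmax
  have h3 : L ≤ Real.log ‖M a b‖ := (Real.le_log_iff_exp_le (by linarith)).mpr hbig.le
  linarith [le_max_right 0 (logNormSum s m v 1 - K)]

/-! ### Boosts and the critical point equation -/

/-- The matrix `exp (t A) = cosh t + sinh t A`, with `A = u · σ` the combination of the Pauli
matrices given by `u`. -/
noncomputable def boost (u : EuclideanSpace ℝ (Fin 3)) (t : ℝ) : Matrix (Fin 2) (Fin 2) ℂ :=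
  !![((Real.cosh t + Real.sinh t * u 2 : ℝ) : ℂ), ⟨Real.sinh t * u 0, -(Real.sinh t * u 1)⟩;
    ⟨Real.sinh t * u 0, Real.sinh t * u 1⟩, ((Real.cosh t - Real.sinh t * u 2 : ℝ) : ℂ)]

theorem sum_sq_eq_one {u : EuclideanSpace ℝ (Fin 3)} (hu : ‖u‖ = 1) :
    u 0 ^ 2 + u 1 ^ 2 + u 2 ^ 2 = 1 := by
  rw [EuclideanSpace.norm_eq, Real.sqrt_eq_one] at hu
  simpa [Fin.sum_univ_three] using hu

theorem det_boost {u : EuclideanSpace ℝ (Fin 3)} (hu : ‖u‖ = 1) (t : ℝ) :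
    (boost u t).det = 1 := by
  have h1 := sum_sq_eq_one hu
  have h2 := Real.cosh_sq t
  rw [boost, Matrix.det_fin_two_of]
  apply Complex.ext
  · simp only [Complex.sub_re, Complex.mul_re, Complex.ofReal_re, Complex.ofReal_im,
      Complex.one_re]
    linear_combination h2 - Real.sinh t ^ 2 * h1
  · simp only [Complex.sub_im, Complex.mul_im, Complex.ofReal_re, Complex.ofReal_im,
      Complex.one_im]
    ring

/-- The boost `exp (t A)` is Hermitian and `A² = 1`, so the left side is `⟨w, exp (2 t A) w⟩`, while
`⟨w, A w⟩` is `hermSq w` times the pairing of `u` with `hopfVec w`. -/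
theorem hermSq_boost_mulVec {u : EuclideanSpace ℝ (Fin 3)} (hu : ‖u‖ = 1) (t : ℝ)
    {w : Fin 2 → ℂ} (hw : w ≠ 0) :
    hermSq ((boost u t).mulVec w) =
      hermSq w * (Real.cosh (2 * t) + inner ℝ u (hopfVec w) * Real.sinh (2 * t)) := by
  have h1 := sum_sq_eq_one hu
  have h2 := Real.cosh_sq t
  have hp : (w 0).re ^ 2 + (w 0).im ^ 2 + ((w 1).re ^ 2 + (w 1).im ^ 2) ≠ 0 := by
    have := (hermSq_pos hw).ne'
    rwa [hermSq, Complex.normSq_apply, Complex.normSq_apply, ← sq, ← sq, ← sq, ← sq] at this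
  simp only [boost, hermSq, hopfVec, PiLp.inner_apply, Fin.sum_univ_three, Matrix.mulVec,
    dotProduct, Fin.sum_univ_two, Matrix.of_apply, Matrix.cons_val, PiLp.smul_apply, smul_eq_mul,
    Complex.normSq_apply, Complex.add_re, Complex.add_im, Complex.mul_re, Complex.mul_im,
    Complex.conj_re, Complex.conj_im, Complex.ofReal_re, Complex.ofReal_im, Real.cosh_two_mul,
    Real.sinh_two_mul, RCLike.inner_apply, conj_trivial, ← sq]
  field_simp
  linear_combination Real.sinh t ^ 2 *
    ((w 0).re ^ 2 + (w 0).im ^ 2 + ((w 1).re ^ 2 + (w 1).im ^ 2)) * h1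

theorem sum_smul_hopfVec_eq_zero_of_isMinOn {ι : Type*} {s : Finset ι} {m : ι → ℕ}
    {v : ι → Fin 2 → ℂ} (hv : ∀ i, v i ≠ 0) {M : Matrix (Fin 2) (Fin 2) ℂ} (hM : M.det = 1)
    (hmin : IsMinOn (logNormSum s m v) {M | M.det = 1} M) :
    ∑ i ∈ s, (m i : ℝ) • hopfVec (M.mulVec (v i)) = 0 := by
  set X := ∑ i ∈ s, (m i : ℝ) • hopfVec (M.mulVec (v i)) with hX
  by_contra hX0
  have hMv : ∀ i, M.mulVec (v i) ≠ 0 := fun i => mulVec_ne_zero_of_det_eq_one hM (hv i)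
  -- In the direction of `X` the derivative is `2 ‖X‖`, which minimality forces to vanish.
  set u := ‖X‖⁻¹ • X with hudef
  have hu : ‖u‖ = 1 := norm_smul_inv_norm (𝕜 := ℝ) hX0
  have hder : HasDerivAt (fun t => logNormSum s m v (boost u t * M))
      (∑ i ∈ s, (m i : ℝ) * (2 * inner ℝ u (hopfVec (M.mulVec (v i))))) 0 := by
    unfold logNormSum
    refine HasDerivAt.fun_sum fun i _ => HasDerivAt.const_mul _ ?_
    simp only [← Matrix.mulVec_mulVec, hermSq_boost_mulVec hu _ (hMv i)]
    have h2 : HasDerivAt (fun t : ℝ => 2 * t) 2 0 := by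
      simpa using (hasDerivAt_id (0 : ℝ)).const_mul 2
    have hin := (h2.cosh.fun_add (h2.sinh.const_mul
      (inner ℝ u (hopfVec (M.mulVec (v i)))))).const_mul (hermSq (M.mulVec (v i)))
    have hpos := (hermSq_pos (hMv i)).ne'
    refine (hin.log (by simpa using hpos)).congr_deriv ?_
    simp only [mul_zero, Real.sinh_zero, Real.cosh_zero, zero_mul, zero_add, add_zero, one_mul,
      mul_one]
    field_simp
  have hloc : IsLocalMin (fun t => logNormSum s m v (boost u t * M)) 0 := by
    refine Filter.Eventually.of_forall fun t => ?_
    have h0 : boost u 0 = 1 := by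
      ext i j; fin_cases i <;> fin_cases j <;> simp [boost] <;> rfl
    simp only [h0, one_mul]
    exact hmin (by simp [det_boost hu, hM])
  have hzero := hloc.hasDerivAt_eq_zero hder
  have hinner : inner ℝ u X = 0 := by
    rw [hX, inner_sum]
    simp only [real_inner_smul_right]
    have : ∑ i ∈ s, (m i : ℝ) * (2 * inner ℝ u (hopfVec (M.mulVec (v i)))) =
      2 * ∑ i ∈ s, (m i : ℝ) * inner ℝ u (hopfVec (M.mulVec (v i))) := by
      rw [Finset.mul_sum]; exact Finset.sum_congr rfl fun _ _ => by ring
    linarith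
  rw [hudef, real_inner_smul_left, real_inner_self_eq_norm_sq] at hinner
  have := norm_pos_iff.mpr hX0
  exact absurd hinner (by positivity)

/-! ### Configurations on the sphere -/

theorem moebius_injective (g : Matrix.SpecialLinearGroup (Fin 2) ℂ) :
    Function.Injective (moebius g) := fun _ _ h =>
  hopfEquiv.symm.injective (MulAction.injective g (hopfEquiv.injective h))

theorem moebius_coe (g : Matrix.SpecialLinearGroup (Fin 2) ℂ) (p : S2) :
    (moebius g p : EuclideanSpace ℝ (Fin 3)) =
      hopfVec ((g : Matrix (Fin 2) (Fin 2) ℂ).mulVec (hopfEquiv.symm p).rep) := by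
  have h : moebius g p = hopfMap (g • Projectivization.mk ℂ (hopfEquiv.symm p).rep
      (Projectivization.rep_nonzero _)) := by
    rw [Projectivization.mk_rep]; rfl
  rw [h]
  rfl

theorem exists_moebius_pair {p q p' q' : S2} (h : p ≠ q) (h' : p' ≠ q') :
    ∃ g, moebius g p = p' ∧ moebius g q = q' := by
  have h2 : MulAction.IsMultiplyPretransitive (Matrix.SpecialLinearGroup (Fin 2) ℂ) CP1 2 :=
    inferInstance
  rw [MulAction.is_two_pretransitive_iff] at h2
  obtain ⟨g, hg, hg'⟩ := h2 (hopfEquiv.symm.injective.ne h) (hopfEquiv.symm.injective.ne h')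
  exact ⟨g, by simp [moebius, hg], by simp [moebius, hg']⟩

theorem rep_det_ne_zero {p q : CP1} (h : p ≠ q) :
    p.rep 0 * q.rep 1 - p.rep 1 * q.rep 0 ≠ 0 := by
  have hli := (Projectivization.linearIndependent_pair_iff_ne (K := ℂ)).mpr h
  have := (Matrix.linearIndependent_rows_iff_isUnit (A := Matrix.of ![p.rep, q.rep])).mp hli
  rw [Matrix.isUnit_iff_isUnit_det, Matrix.det_fin_two] at this
  simpa using this.ne_zero

namespace PointConfig

theorem total_eq_sum (D : PointConfig) : D.total = ∑ p ∈ D.support, D p := rfl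

theorem total_move (g : Matrix.SpecialLinearGroup (Fin 2) ℂ) (D : PointConfig) :
    (D.move g).total = D.total :=
  Finsupp.sum_mapDomain_index (fun _ => rfl) fun _ _ _ => rfl

theorem total_pos {D : PointConfig} (hD : D ≠ 0) : 0 < D.total :=
  Finset.sum_pos (fun _ hp => Nat.pos_of_ne_zero (Finsupp.mem_support_iff.mp hp))
    (Finsupp.support_nonempty_iff.mpr hD)

theorem centreOfMass_move_eq_zero_iff {D : PointConfig} (hD : D ≠ 0)
    (g : Matrix.SpecialLinearGroup (Fin 2) ℂ) :
    (D.move g).centreOfMass = 0 ↔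
      ∑ p ∈ D.support, (D p : ℝ) • (moebius g p : EuclideanSpace ℝ (Fin 3)) = 0 := by
  have hn : ((D.total : ℝ)⁻¹) ≠ 0 := inv_ne_zero (Nat.cast_ne_zero.mpr (total_pos hD).ne')
  have hs : ((D.move g).sum fun p m => (m : ℝ) • (p : EuclideanSpace ℝ (Fin 3))) =
      ∑ p ∈ D.support, (D p : ℝ) • (moebius g p : EuclideanSpace ℝ (Fin 3)) :=
    Finsupp.sum_mapDomain_index (by simp) (by simp [add_smul])
  rw [centreOfMass, total_move, hs, smul_eq_zero_iff_right hn]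

/-- A stable configuration can be balanced. -/
theorem exists_sum_eq_zero_of_lt {D : PointConfig} (hD : D ≠ 0)
    (h : ∀ p : S2, (D p : ℝ) < (D.total : ℝ) / 2) :
    ∃ g, ∑ p ∈ D.support, (D p : ℝ) • (moebius g p : EuclideanSpace ℝ (Fin 3)) = 0 := by
  have hm : ∀ p ∈ D.support, 2 * D p < ∑ q ∈ D.support, D q := by
    intro p _
    have := h p
    rw [lt_div_iff₀ two_pos, mul_comm] at this
    exact_mod_cast this
  have hv : ∀ p : S2, (hopfEquiv.symm p).rep ≠ 0 := fun p => Projectivization.rep_nonzero _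
  obtain ⟨M, hM, hmin⟩ := exists_isMinOn_logNormSum (Finsupp.support_nonempty_iff.mpr hD) hm hv
    fun p _ q _ hpq => rep_det_ne_zero (hopfEquiv.symm.injective.ne hpq)
  obtain ⟨g, rfl⟩ : ∃ g : Matrix.SpecialLinearGroup (Fin 2) ℂ, (g : Matrix _ _ ℂ) = M :=
    ⟨⟨M, hM⟩, rfl⟩
  refine ⟨g, ?_⟩
  simp only [moebius_coe]
  exact sum_smul_hopfVec_eq_zero_of_isMinOn hv hM hmin

/-- Two points of equal multiplicity can be made antipodal. -/
theorem exists_sum_eq_zero_of_pair {D : PointConfig} (h : D.support.card = 2)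
    (hD : ∀ p ∈ D.support, ∀ q ∈ D.support, D p = D q) :
    ∃ g, ∑ p ∈ D.support, (D p : ℝ) • (moebius g p : EuclideanSpace ℝ (Fin 3)) = 0 := by
  obtain ⟨p, q, hpq, hs⟩ := Finset.card_eq_two.mp h
  -- Fix `p` and send `q` to the antipode of `p`.
  obtain ⟨g, hp, hq⟩ := exists_moebius_pair hpq (ne_neg_of_mem_unit_sphere ℝ p)
  refine ⟨g, ?_⟩
  rw [hs, Finset.sum_pair hpq, hp, hq, hD p (by simp [hs]) q (by simp [hs])]
  simp

/-- In a balanced configuration with a point of at least half the total multiplicity, that point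
has exactly half, and all the others lie at its antipode. -/
theorem card_eq_two_of_sum_eq_zero {D : PointConfig} {f : S2 → S2} (hf : Function.Injective f)
    (h : ∑ p ∈ D.support, (D p : ℝ) • (f p : EuclideanSpace ℝ (Fin 3)) = 0)
    {p : S2} (hp : p ∈ D.support) (hpD : (D.total : ℝ) / 2 ≤ D p) :
    D.support.card = 2 ∧ ∀ p ∈ D.support, ∀ q ∈ D.support, D p = D q := by
  classical
  have hn : ∀ q : S2, ‖(f q : EuclideanSpace ℝ (Fin 3))‖ = 1 := fun q => by simp
  have hDp : 0 < D p := Nat.pos_of_ne_zero (Finsupp.mem_support_iff.mp hp)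
  have hle : ∀ q, -1 ≤ inner ℝ (f p : EuclideanSpace ℝ (Fin 3)) (f q) := fun q => by
    have := neg_le_of_abs_le (abs_real_inner_le_norm (f p : EuclideanSpace ℝ (Fin 3)) (f q))
    simpa [hn] using this
  have hin : ∑ q ∈ D.support, (D q : ℝ) * inner ℝ (f p : EuclideanSpace ℝ (Fin 3)) (f q) = 0 := by
    have := congrArg (fun x => inner ℝ (f p : EuclideanSpace ℝ (Fin 3)) x) h
    simpa [inner_sum, real_inner_smul_right] using this
  have htot : (D.total : ℝ) = D p + ∑ q ∈ D.support.erase p, (D q : ℝ) := by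
    rw [Finset.add_sum_erase _ (fun q => (D q : ℝ)) hp, total_eq_sum]; push_cast; rfl
  rw [← Finset.add_sum_erase _ _ hp, real_inner_self_eq_norm_sq, hn] at hin
  have hterm : ∀ q ∈ D.support.erase p,
      0 ≤ (D q : ℝ) * (inner ℝ (f p : EuclideanSpace ℝ (Fin 3)) (f q) + 1) := fun q _ =>
    mul_nonneg (Nat.cast_nonneg _) (by linarith [hle q])
  have hsum : ∑ q ∈ D.support.erase p,
      (D q : ℝ) * (inner ℝ (f p : EuclideanSpace ℝ (Fin 3)) (f q) + 1) =
        ∑ q ∈ D.support.erase p, (D q : ℝ) - D p := by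
    simp only [mul_add, Finset.sum_add_distrib, mul_one]
    linarith
  -- The sum has nonnegative terms and equals the mass away from `p` minus `D p`, which is at most
  -- zero because `p` carries half the total.
  have hsum0 : ∑ q ∈ D.support.erase p,
      (D q : ℝ) * (inner ℝ (f p : EuclideanSpace ℝ (Fin 3)) (f q) + 1) = 0 :=
    le_antisymm (by rw [hsum]; linarith) (Finset.sum_nonneg hterm)
  have hanti : ∀ q ∈ D.support.erase p, f q = -f p := by
    intro q hq
    have h0 := (Finset.sum_eq_zero_iff_of_nonneg hterm).mp hsum0 q hq
    have hDq : (D q : ℝ) ≠ 0 :=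
      Nat.cast_ne_zero.mpr (Finsupp.mem_support_iff.mp (Finset.mem_of_mem_erase hq))
    have h1 : inner ℝ (f p : EuclideanSpace ℝ (Fin 3)) (f q) = -1 := by
      linarith [(mul_eq_zero.mp h0).resolve_left hDq]
    rw [inner_eq_neg_one_iff_of_norm_eq_one (hn p) (hn q)] at h1
    exact Subtype.ext (neg_eq_iff_eq_neg.mpr h1).symm
  have hne : (D.support.erase p).Nonempty := by
    rw [Finset.nonempty_iff_ne_empty]
    intro he
    rw [hsum0, he, Finset.sum_empty] at hsum
    have : (0 : ℝ) < D p := Nat.cast_pos.mpr hDp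
    linarith
  obtain ⟨q, hq⟩ := hne
  have herase : D.support.erase p = {q} := Finset.eq_singleton_iff_unique_mem.mpr
    ⟨hq, fun r hr => hf ((hanti r hr).trans (hanti q hq).symm)⟩
  have hsupp : D.support = {p, q} := by rw [← Finset.insert_erase hp, herase]
  have hpq : D p = D q := by
    rw [hsum0, herase, Finset.sum_singleton] at hsum
    exact_mod_cast (sub_eq_zero.mp hsum.symm).symm
  refine ⟨by rw [hsupp, Finset.card_pair (Finset.ne_of_mem_erase hq).symm], ?_⟩
  simp [hsupp, hpq]

end PointConfig

theorem mainTheorem9 (D : PointConfig) (hD : D ≠ 0) :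
    (∃ g : Matrix.SpecialLinearGroup (Fin 2) ℂ, (D.move g).centreOfMass = 0) ↔
      ((∀ p : S2, (D p : ℝ) < (D.total : ℝ) / 2) ∨
        (D.support.card = 2 ∧ ∀ p ∈ D.support, ∀ q ∈ D.support, D p = D q)) := by
  simp only [PointConfig.centreOfMass_move_eq_zero_iff hD]
  constructor
  · rintro ⟨g, hg⟩
    by_contra! hcon
    obtain ⟨⟨p, hp⟩, hcon⟩ := hcon
    have hpos : (0 : ℝ) < D.total := Nat.cast_pos.mpr (PointConfig.total_pos hD)
    have hps : p ∈ D.support := Finsupp.mem_support_iff.mpr fun h0 => by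
      rw [h0, Nat.cast_zero] at hp; linarith
    obtain ⟨h2, heq⟩ := PointConfig.card_eq_two_of_sum_eq_zero (moebius_injective g) hg hps hp
    obtain ⟨q, hq, r, hr, hne⟩ := hcon h2
    exact hne (heq q hq r hr)
  · rintro (h | ⟨h2, heq⟩)
    · exact PointConfig.exists_sum_eq_zero_of_lt hD h
    · exact PointConfig.exists_sum_eq_zero_of_pair h2 heq
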